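/- Consider propositional linear logic without variables: formulae are generated by $0,\ 1,\ A\otimes B,\ A\oplus B,\ {?}A,\ \top,\ \bot,\ A\parr B,\ A\mathbin{\&}B,\ {!}A$, with linear negation $A^\bot$ given by De Morgan duality ($0/\top$, $1/\bot$, $\otimes/\parr$, $\oplus/\&$, ${?}/{!}$); sequents are finite lists of formulae, read one-sidedly. Let: - $\mathrm{LL}$ be the usual one-sided sequent calculus (axiom, cut, exchange, the rules for $1,\bot,\top,\otimes,\parr,\oplus,\&$, and weakening, contraction, dereliction and promotion); - $\mathrm{LLT}$ be the calculus obtained from $\mathrm{LL}$ by replacing the tensor rule with: from $\Gamma,{?}\Theta,A$ and $\Delta,{?}\Theta,B$ infer $\Gamma,\Delta,{?}\Theta,A\otimes B$; - $\mathrm{LLT}_n$ (also written LLTN) be the calculus with cut, exchange, the rules of $\mathrm{LLT}$ for $1,\bot,\top,\otimes,\parr,\oplus,\&$, no axiom rule, and, as only rules for the exponentials: from $\Gamma,\parr^n A$ infer $\Gamma,{?}A$ (for any $n\in\mathbb N$), and from the infinite family of premises $\Gamma,\otimes^n A$ (one for each $n\in\mathbb N$) infer $\Gamma,{!}A$. Here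 $\parr^0A=\bot$, $\parr^{n+1}A=(\parr^nA)\parr A$, $\otimes^0A=1$, $\otimes^{n+1}A=(\otimes^nA)\otimes A$. Proofs are trees all of whose branches are finite. A proof in LLTN is *bounded* if it is either cut-free, or a single final cut of a cut-free proof of a one-formula sequent $A$ against a cut-free proof of $A^\bot,\Gamma$, with conclusion $\Gamma$. **Proposition.** $\mathrm{LLT}$ is not a model of LLTN: it is not the case that every sequent provable in LLTN is provable in $\mathrm{LLT}$, and it is not even the case that every sequent with a bounded proof in LLTN is provable in $\mathrm{LLT}$. More precisely, for $X=\bot\otimes\bot$, the sequent $$\bot\oplus(X^\bot\parr{?}X^\bot),\ {!}X$$ has a bounded proof in LLTN, but is provable neither in $\mathrm{LL}$ nor in $\mathrm{LLT}$. -/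

import Mathlib

namespace LinearLogic

/-- Formulae of propositional linear logic, built from the constants only
(there are no propositional variables). -/
inductive Formula : Type
  | zero : Formula
  | one : Formula
  | tensor : Formula → Formula → Formula
  | plus : Formula → Formula → Formula
  | whyNot : Formula → Formula
  | top : Formula
  | bot : Formula
  | par : Formula → Formula → Formula
  | with : Formula → Formula → Formula
  | ofCourse : Formula → Formula

namespace Formula

/-- Linear negation, by De Morgan duality. -/
def dual : Formula → Formula
  | zero => top
  | one => bot
  | tensor A B => par A.dual B.dual
  | plus A B => .with A.dual B.dual
  | whyNot A => ofCourse A.dual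
  | top => zero
  | bot => one
  | par A B => tensor A.dual B.dual
  | .with A B => plus A.dual B.dual
  | ofCourse A => whyNot A.dual

/-- The `n`-fold tensor: `⊗⁰ A = 1` and `⊗ⁿ⁺¹ A = (⊗ⁿ A) ⊗ A`. -/
def tensorPow (A : Formula) : ℕ → Formula
  | 0 => one
  | n + 1 => tensor (tensorPow A n) A

/-- The `n`-fold par: `⅋⁰ A = ⊥` and `⅋ⁿ⁺¹ A = (⅋ⁿ A) ⅋ A`. -/
def parPow (A : Formula) : ℕ → Formula
  | 0 => bot
  | n + 1 => par (parPow A n) A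

end Formula

open Formula

/-- One-sided sequents are lists of formulae. -/
abbrev Sequent : Type := List Formula

/-- `?Θ`: the list of the formulae `?A`, for `A` in `Θ`. -/
abbrev whyNots (Θ : List Formula) : Sequent := Θ.map whyNot

/-- Provability in (full) linear logic LL, with cut. -/
inductive LL : Sequent → Prop
  | ax (A : Formula) : LL [A, A.dual]
  | cut (Γ Δ : Sequent) (A : Formula) : LL (Γ ++ [A]) → LL (Δ ++ [A.dual]) → LL (Γ ++ Δ)
  | exchange (Γ Δ : Sequent) (A B : Formula) : LL (Γ ++ [B, A] ++ Δ) → LL (Γ ++ [A, B] ++ Δ)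
  | one : LL [one]
  | bot (Γ : Sequent) : LL Γ → LL (Γ ++ [bot])
  | top (Γ : Sequent) : LL (Γ ++ [top])
  | tensor (Γ Δ : Sequent) (A B : Formula) :
      LL (Γ ++ [A]) → LL (Δ ++ [B]) → LL (Γ ++ Δ ++ [tensor A B])
  | par (Γ : Sequent) (A B : Formula) : LL (Γ ++ [A, B]) → LL (Γ ++ [par A B])
  | plusLeft (Γ : Sequent) (A B : Formula) : LL (Γ ++ [A]) → LL (Γ ++ [plus A B])
  | plusRight (Γ : Sequent) (A B : Formula) : LL (Γ ++ [B]) → LL (Γ ++ [plus A B])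
  | with (Γ : Sequent) (A B : Formula) :
      LL (Γ ++ [A]) → LL (Γ ++ [B]) → LL (Γ ++ [.with A B])
  | weakening (Γ : Sequent) (A : Formula) : LL Γ → LL (Γ ++ [whyNot A])
  | contraction (Γ : Sequent) (A : Formula) :
      LL (Γ ++ [whyNot A, whyNot A]) → LL (Γ ++ [whyNot A])
  | dereliction (Γ : Sequent) (A : Formula) : LL (Γ ++ [A]) → LL (Γ ++ [whyNot A])
  | promotion (Γ : List Formula) (A : Formula) :
      LL (whyNots Γ ++ [A]) → LL (whyNots Γ ++ [ofCourse A])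

/-- Provability in LLT: the rules of LL, except that the tensor rule is replaced by the variant
in which the two premises share a list `?Θ` of why-not formulae. -/
inductive LLT : Sequent → Prop
  | ax (A : Formula) : LLT [A, A.dual]
  | cut (Γ Δ : Sequent) (A : Formula) : LLT (Γ ++ [A]) → LLT (Δ ++ [A.dual]) → LLT (Γ ++ Δ)
  | exchange (Γ Δ : Sequent) (A B : Formula) : LLT (Γ ++ [B, A] ++ Δ) → LLT (Γ ++ [A, B] ++ Δ)
  | one : LLT [one]
  | bot (Γ : Sequent) : LLT Γ → LLT (Γ ++ [bot])
  | top (Γ : Sequent) : LLT (Γ ++ [top])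
  | tensor (Γ Δ : Sequent) (Θ : List Formula) (A B : Formula) :
      LLT (Γ ++ whyNots Θ ++ [A]) → LLT (Δ ++ whyNots Θ ++ [B]) →
        LLT (Γ ++ Δ ++ whyNots Θ ++ [tensor A B])
  | par (Γ : Sequent) (A B : Formula) : LLT (Γ ++ [A, B]) → LLT (Γ ++ [par A B])
  | plusLeft (Γ : Sequent) (A B : Formula) : LLT (Γ ++ [A]) → LLT (Γ ++ [plus A B])
  | plusRight (Γ : Sequent) (A B : Formula) : LLT (Γ ++ [B]) → LLT (Γ ++ [plus A B])
  | with (Γ : Sequent) (A B : Formula) :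
      LLT (Γ ++ [A]) → LLT (Γ ++ [B]) → LLT (Γ ++ [.with A B])
  | weakening (Γ : Sequent) (A : Formula) : LLT Γ → LLT (Γ ++ [whyNot A])
  | contraction (Γ : Sequent) (A : Formula) :
      LLT (Γ ++ [whyNot A, whyNot A]) → LLT (Γ ++ [whyNot A])
  | dereliction (Γ : Sequent) (A : Formula) : LLT (Γ ++ [A]) → LLT (Γ ++ [whyNot A])
  | promotion (Γ : List Formula) (A : Formula) :
      LLT (whyNots Γ ++ [A]) → LLT (whyNots Γ ++ [ofCourse A])

namespace LLTN

/-- Proofs in LLTN: well-founded trees of inference rules. The rule for `!A` has one premise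
for each `n : ℕ`. -/
inductive Proof : Sequent → Type
  | cut (Γ Δ : Sequent) (A : Formula) :
      Proof (Γ ++ [A]) → Proof (Δ ++ [A.dual]) → Proof (Γ ++ Δ)
  | exchange (Γ Δ : Sequent) (A B : Formula) :
      Proof (Γ ++ [B, A] ++ Δ) → Proof (Γ ++ [A, B] ++ Δ)
  | one : Proof [one]
  | bot (Γ : Sequent) : Proof Γ → Proof (Γ ++ [bot])
  | top (Γ : Sequent) : Proof (Γ ++ [top])
  | tensor (Γ Δ : Sequent) (Θ : List Formula) (A B : Formula) :
      Proof (Γ ++ whyNots Θ ++ [A]) → Proof (Δ ++ whyNots Θ ++ [B]) →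
        Proof (Γ ++ Δ ++ whyNots Θ ++ [tensor A B])
  | par (Γ : Sequent) (A B : Formula) : Proof (Γ ++ [A, B]) → Proof (Γ ++ [par A B])
  | plusLeft (Γ : Sequent) (A B : Formula) : Proof (Γ ++ [A]) → Proof (Γ ++ [plus A B])
  | plusRight (Γ : Sequent) (A B : Formula) : Proof (Γ ++ [B]) → Proof (Γ ++ [plus A B])
  | with (Γ : Sequent) (A B : Formula) :
      Proof (Γ ++ [A]) → Proof (Γ ++ [B]) → Proof (Γ ++ [.with A B])
  | whyNot (Γ : Sequent) (A : Formula) (n : ℕ) :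
      Proof (Γ ++ [A.parPow n]) → Proof (Γ ++ [whyNot A])
  | ofCourse (Γ : Sequent) (A : Formula) :
      (∀ n : ℕ, Proof (Γ ++ [A.tensorPow n])) → Proof (Γ ++ [ofCourse A])

/-- A proof is cut-free when the cut rule is used nowhere in it. -/
def Proof.CutFree : {Γ : Sequent} → Proof Γ → Prop
  | _, .cut _ _ _ _ _ => False
  | _, .exchange _ _ _ _ π => π.CutFree
  | _, .one => True
  | _, .bot _ π => π.CutFree
  | _, .top _ => True
  | _, .tensor _ _ _ _ _ π ρ => π.CutFree ∧ ρ.CutFree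
  | _, .par _ _ _ π => π.CutFree
  | _, .plusLeft _ _ _ π => π.CutFree
  | _, .plusRight _ _ _ π => π.CutFree
  | _, .with _ _ _ π ρ => π.CutFree ∧ ρ.CutFree
  | _, .whyNot _ _ _ π => π.CutFree
  | _, .ofCourse _ _ π => ∀ n : ℕ, (π n).CutFree

/-- A proof is bounded when it is cut-free, or consists of a single final cut between a cut-free
proof of the one-formula sequent `A` and a cut-free proof of `Γ, A^⊥`. -/
inductive Proof.Bounded : {Γ : Sequent} → Proof Γ → Prop
  | cutFree {Γ : Sequent} (π : Proof Γ) : π.CutFree → Bounded π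
  | cut (Γ : Sequent) (A : Formula) (π₁ : Proof [A]) (π₂ : Proof (Γ ++ [A.dual])) :
      π₁.CutFree → π₂.CutFree → Bounded (Proof.cut [] Γ A π₁ π₂)

/-- Provability in LLTN. -/
def Provable (Γ : Sequent) : Prop := Nonempty (Proof Γ)

/-- Having a bounded proof in LLTN. -/
def BoundedProvable (Γ : Sequent) : Prop := ∃ π : Proof Γ, π.Bounded

end LLTN

/-- The validity notion `V` is a model of the provability notion `P` when every `P`-provable
sequent is `V`-valid. -/
def IsModelOf (V P : Sequent → Prop) : Prop := ∀ Γ : Sequent, P Γ → V Γ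

/-- The formula `X = ⊥ ⊗ ⊥`. -/
def botTensorBot : Formula := tensor bot bot

/-- The sequent `⊥ ⊕ (X^⊥ ⅋ ?X^⊥), !X`. -/
def laurentSequent (X : Formula) : Sequent :=
  [plus bot (par X.dual (whyNot X.dual)), ofCourse X]

end LinearLogic

/-!
In LLTN, `!X` is entailed by all the finite powers `⊗ⁿ X` together, and `1 & (X ⊗ !X)` entails each
of them: use `1` for `n = 0` and `X ⊗ !X` for `n + 1`. For LLT, phase semantics is sound as soon as
weakening and contraction hold for the elements interpreting the exponentials, and some phase space
refutes `1 & (X ⊗ !X) ⊢ !X`. The countermodel rests on the numerical semigroups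
`{0} ⊂ ℕ ∖ {1} ⊂ ℕ`: `ℕ ∖ {1}` contains both `{0}` and `2 + ℕ`, so it plays the part of
`1 & (X ⊗ !X)` when `ℕ` plays that of `!X`, but it is not all of `ℕ`.
-/

namespace LinearLogic

open Formula

open scoped Pointwise

namespace LLTN

/-- The sequents with a cut-free proof in LLTN; such a proof is in particular bounded. -/
def CutFreeProvable (Γ : Sequent) : Prop := ∃ π : Proof Γ, π.CutFree

theorem CutFreeProvable.boundedProvable {Γ : Sequent} (h : CutFreeProvable Γ) :
    BoundedProvable Γ :=
  let ⟨π, hπ⟩ := h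
  ⟨π, .cutFree π hπ⟩

theorem BoundedProvable.provable {Γ : Sequent} (h : BoundedProvable Γ) : Provable Γ :=
  let ⟨π, _⟩ := h
  ⟨π⟩

namespace CutFreeProvable

variable {A B : Formula} {Γ Δ : Sequent}

theorem one : CutFreeProvable [one] := ⟨.one, trivial⟩

theorem bot (h : CutFreeProvable Γ) : CutFreeProvable (Γ ++ [bot]) :=
  let ⟨π, hπ⟩ := h
  ⟨.bot Γ π, hπ⟩

theorem top (Γ : Sequent) : CutFreeProvable (Γ ++ [top]) := ⟨.top Γ, trivial⟩

theorem exchange (h : CutFreeProvable (Γ ++ [B, A] ++ Δ)) : CutFreeProvable (Γ ++ [A, B] ++ Δ) :=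
  let ⟨π, hπ⟩ := h
  ⟨.exchange Γ Δ A B π, hπ⟩

theorem tensor (hA : CutFreeProvable (Γ ++ [A])) (hB : CutFreeProvable (Δ ++ [B])) :
    CutFreeProvable (Γ ++ Δ ++ [tensor A B]) := by
  rw [← Γ.append_nil] at hA
  rw [← Δ.append_nil] at hB
  rw [← (Γ ++ Δ).append_nil]
  obtain ⟨π, hπ⟩ := hA
  obtain ⟨ρ, hρ⟩ := hB
  exact ⟨.tensor Γ Δ [] A B π ρ, hπ, hρ⟩

theorem par (h : CutFreeProvable (Γ ++ [A, B])) : CutFreeProvable (Γ ++ [par A B]) :=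
  let ⟨π, hπ⟩ := h
  ⟨.par Γ A B π, hπ⟩

theorem plusLeft (h : CutFreeProvable (Γ ++ [A])) : CutFreeProvable (Γ ++ [plus A B]) :=
  let ⟨π, hπ⟩ := h
  ⟨.plusLeft Γ A B π, hπ⟩

theorem plusRight (h : CutFreeProvable (Γ ++ [B])) : CutFreeProvable (Γ ++ [plus A B]) :=
  let ⟨π, hπ⟩ := h
  ⟨.plusRight Γ A B π, hπ⟩

theorem with_intro (hA : CutFreeProvable (Γ ++ [A])) (hB : CutFreeProvable (Γ ++ [B])) :
    CutFreeProvable (Γ ++ [.with A B]) :=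
  let ⟨π, hπ⟩ := hA
  let ⟨ρ, hρ⟩ := hB
  ⟨.with Γ A B π ρ, hπ, hρ⟩

theorem whyNot (n : ℕ) (h : CutFreeProvable (Γ ++ [A.parPow n])) :
    CutFreeProvable (Γ ++ [whyNot A]) :=
  let ⟨π, hπ⟩ := h
  ⟨.whyNot Γ A n π, hπ⟩

theorem ofCourse (h : ∀ n : ℕ, CutFreeProvable (Γ ++ [A.tensorPow n])) :
    CutFreeProvable (Γ ++ [ofCourse A]) := by
  choose π hπ using h
  exact ⟨.ofCourse Γ A π, hπ⟩

theorem append_perm (hΓΔ : Γ.Perm Δ) (Λ : Sequent) (h : CutFreeProvable (Λ ++ Γ)) :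
    CutFreeProvable (Λ ++ Δ) := by
  induction hΓΔ generalizing Λ with
  | nil => exact h
  | cons A _ ih =>
    rw [List.append_cons] at h ⊢
    exact ih (Λ ++ [A]) h
  | swap A B Γ =>
    have := exchange (Γ := Λ) (A := A) (B := B) (Δ := Γ) (by simpa using h)
    simpa using this
  | trans _ _ ih₁ ih₂ => exact ih₂ Λ (ih₁ Λ h)

theorem perm (h : CutFreeProvable Γ) (hΓΔ : Γ.Perm Δ) : CutFreeProvable Δ :=
  append_perm hΓΔ [] h

theorem swap (h : CutFreeProvable [A, B]) : CutFreeProvable [B, A] :=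
  h.perm (.swap B A [])

theorem one_bot : CutFreeProvable [.one, .bot] := one.bot

theorem tensor_par {A' B' : Formula} (hA : CutFreeProvable [A', A])
    (hB : CutFreeProvable [B', B]) : CutFreeProvable [.tensor A B, .par A' B'] :=
  have h : CutFreeProvable [A', B', .tensor A B] := tensor (Γ := [A']) (Δ := [B']) hA hB
  par (Γ := [.tensor A B]) (h.perm (List.perm_append_comm (l₁ := [A', B'])))

theorem plus_with {A' B' : Formula} (hA : CutFreeProvable [A, A'])
    (hB : CutFreeProvable [B, B']) : CutFreeProvable [.plus A B, .with A' B'] :=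
  with_intro (Γ := [.plus A B])
    (swap (plusLeft (Γ := [A']) hA.swap)) (swap (plusRight (Γ := [B']) hB.swap))

theorem parPow_tensorPow {A' : Formula} (h : CutFreeProvable [A', A]) :
    ∀ n : ℕ, CutFreeProvable [A'.parPow n, A.tensorPow n]
  | 0 => one_bot.swap
  | n + 1 => (tensor_par (parPow_tensorPow h n) h).swap

theorem whyNot_ofCourse {A' : Formula} (h : CutFreeProvable [A', A]) :
    CutFreeProvable [.whyNot A', .ofCourse A] :=
  ofCourse (Γ := [.whyNot A']) fun n =>
    swap (whyNot (Γ := [A.tensorPow n]) n (parPow_tensorPow h n).swap)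

theorem dual_self (A : Formula) : CutFreeProvable [A.dual, A] := by
  induction A with
  | zero => exact (top [.zero]).swap
  | one => exact one_bot.swap
  | tensor A B hA hB => exact (tensor_par hA hB).swap
  | plus A B hA hB => exact (plus_with hA.swap hB.swap).swap
  | whyNot A hA => exact (whyNot_ofCourse hA.swap).swap
  | top => exact top [.zero]
  | bot => exact one_bot
  | par A B hA hB => exact tensor_par hA.swap hB.swap
  | ofCourse A hA => exact whyNot_ofCourse hA
  | _ A B hA hB => exact plus_with hA hB

theorem laurentSequent (X : Formula) : CutFreeProvable (laurentSequent X) := by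
  refine ofCourse (Γ := [.plus .bot (.par X.dual (.whyNot X.dual))]) fun n => swap ?_
  cases n with
  | zero => exact plusLeft (Γ := [.one]) one_bot
  | succ n =>
    have h : CutFreeProvable [X.dual.parPow n, X.dual, X.tensorPow (n + 1)] :=
      tensor (Γ := [X.dual.parPow n]) (Δ := [X.dual])
        (parPow_tensorPow (dual_self X) n) (dual_self X)
    have h' : CutFreeProvable [X.tensorPow (n + 1), X.dual, .whyNot X.dual] :=
      whyNot (Γ := [X.tensorPow (n + 1), X.dual]) n (h.perm (List.reverse_perm _).symm)
    exact plusRight (Γ := [X.tensorPow (n + 1)]) (par (Γ := [X.tensorPow (n + 1)]) h')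

end CutFreeProvable

end LLTN

theorem LL.llt {Γ : Sequent} (h : LL Γ) : LLT Γ := by
  induction h with
  | ax A => exact .ax A
  | cut Γ Δ A _ _ h₁ h₂ => exact .cut Γ Δ A h₁ h₂
  | exchange Γ Δ A B _ h => exact .exchange Γ Δ A B h
  | one => exact .one
  | bot Γ _ h => exact .bot Γ h
  | top Γ => exact .top Γ
  | tensor Γ Δ A B _ _ h₁ h₂ => simpa using LLT.tensor Γ Δ [] A B (by simpa) (by simpa)
  | par Γ A B _ h => exact .par Γ A B h
  | plusLeft Γ A B _ h => exact .plusLeft Γ A B h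
  | plusRight Γ A B _ h => exact .plusRight Γ A B h
  | weakening Γ A _ h => exact .weakening Γ A h
  | contraction Γ A _ h => exact .contraction Γ A h
  | dereliction Γ A _ h => exact .dereliction Γ A h
  | promotion Γ A _ h => exact .promotion Γ A h
  | _ Γ A B _ _ h₁ h₂ => exact .with Γ A B h₁ h₂

/-- Phase spaces, written additively: a commutative monoid with a subset `pole` interpreting `⊥`,
and a submonoid `exps` interpreting the exponentials. Rather than being idempotent, the elements of
`exps` are only asked to satisfy contraction with respect to the pole; the field `weaken` places
them in the interpretation of `1`. -/
structure PhaseSpace (M : Type*) [AddCommMonoid M] where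
  pole : Set M
  exps : AddSubmonoid M
  weaken : ∀ {m k : M}, m ∈ pole → k ∈ exps → m + k ∈ pole
  contract : ∀ {m k : M}, k ∈ exps → m + k + k ∈ pole → m + k ∈ pole

namespace PhaseSpace

variable {M : Type*} [AddCommMonoid M] (S : PhaseSpace M)

/-- The orthogonal of a set in a phase space, which interprets linear negation. -/
def perp (s : Set M) : Set M := upperPolar (fun x y => x + y ∈ S.pole) s

theorem perp_eq_lowerPolar (s : Set M) :
    S.perp s = lowerPolar (fun x y => x + y ∈ S.pole) s := by
  simp only [perp, upperPolar, lowerPolar, add_comm]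

theorem perp_anti {s t : Set M} (h : s ⊆ t) : S.perp t ⊆ S.perp s := upperPolar_anti _ h

theorem subset_perp_perp (s : Set M) : s ⊆ S.perp (S.perp s) := by
  rw [S.perp_eq_lowerPolar (S.perp s)]
  exact subset_lowerPolar_upperPolar _ s

theorem perp_perp_perp (s : Set M) : S.perp (S.perp (S.perp s)) = S.perp s := by
  rw [S.perp_eq_lowerPolar (S.perp s)]
  exact upperPolar_lowerPolar_upperPolar _ s

theorem perp_union (s t : Set M) : S.perp (s ∪ t) = S.perp s ∩ S.perp t :=
  upperPolar_union _ s t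

theorem perp_singleton_zero : S.perp {0} = S.pole := by
  ext m
  simp [perp]

theorem subset_perp_iff {s t : Set M} : s ⊆ S.perp t ↔ s + t ⊆ S.pole := by
  rw [perp_eq_lowerPolar, Set.add_subset_iff]
  rfl

theorem add_perp_perp_subset_pole_iff {s t : Set M} :
    s + S.perp (S.perp t) ⊆ S.pole ↔ s + t ⊆ S.pole := by
  rw [← subset_perp_iff, perp_perp_perp, subset_perp_iff]

theorem add_subset_pole_of_add_add {s t : Set M} (ht : t ⊆ S.exps) (h : s + t + t ⊆ S.pole) :
    s + t ⊆ S.pole :=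
  Set.add_subset_iff.2 fun _ hx _ hk =>
    S.contract (ht hk) (h (Set.add_mem_add (Set.add_mem_add hx hk) hk))

/-- The interpretation of formulae in a phase space, by sets that are closed under double
orthogonality. -/
def interp : Formula → Set M
  | .zero => S.perp Set.univ
  | .one => S.perp S.pole
  | .tensor A B => S.perp (S.perp (interp A + interp B))
  | .plus A B => S.perp (S.perp (interp A ∪ interp B))
  | .whyNot A => S.perp (S.perp (interp A) ∩ S.exps)
  | .top => Set.univ
  | .bot => S.pole
  | .par A B => S.perp (S.perp (interp A) + S.perp (interp B))
  | .with A B => interp A ∩ interp B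
  | .ofCourse A => S.perp (S.perp (interp A ∩ S.exps))

theorem perp_perp_interp (A : Formula) : S.perp (S.perp (S.interp A)) = S.interp A := by
  induction A with
  | top => exact Set.univ_subset_iff.mp (S.subset_perp_perp _)
  | bot => rw [interp, ← perp_singleton_zero, perp_perp_perp]
  | zero | one | tensor | plus | whyNot | par | ofCourse => exact S.perp_perp_perp _
  | _ A B hA hB => rw [interp, ← hA, ← hB, ← perp_union, perp_perp_perp]

theorem interp_dual (A : Formula) : S.interp A.dual = S.perp (S.interp A) := by
  induction A with
  | zero => exact (S.perp_perp_interp .top).symm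
  | one => exact (S.perp_perp_interp .bot).symm
  | top | bot => rfl
  | plus A B hA hB => rw [dual, interp, interp, hA, hB, perp_perp_perp, perp_union]
  | _ => simp only [dual, interp, perp_union, perp_perp_perp, perp_perp_interp, *]

/-- The sums of one refutation for each formula of a sequent, a refutation of `A` being an element
of the interpretation of `A^⊥`. -/
def refutations (Γ : Sequent) : Set M := (Γ.map fun A => S.perp (S.interp A)).sum

/-- Validity in a phase space of a sequent, read as the par of its formulae; LLT is sound for it. -/
def Valid (Γ : Sequent) : Prop := S.refutations Γ ⊆ S.pole

/-- The sums of one refutation in `exps` for each formula of a list: the only ones against which the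
part `?Θ` of a sequent needs to be tested. -/
def expRefutations (Θ : List Formula) : Set M :=
  (Θ.map fun A => S.perp (S.interp A) ∩ (S.exps : Set M)).sum

variable {S} {Γ Δ : Sequent} {Θ : List Formula} {A B : Formula}

theorem refutations_nil : S.refutations [] = 0 := rfl

theorem refutations_append : S.refutations (Γ ++ Δ) = S.refutations Γ + S.refutations Δ := by
  simp only [refutations, List.map_append, List.sum_append]

theorem refutations_singleton : S.refutations [A] = S.perp (S.interp A) := by
  simp only [refutations, List.map_singleton, List.sum_singleton]

theorem expRefutations_cons :
    S.expRefutations (A :: Θ) = S.perp (S.interp A) ∩ S.exps + S.expRefutations Θ := by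
  simp only [expRefutations, List.map_cons, List.sum_cons]

theorem expRefutations_subset_exps : S.expRefutations Θ ⊆ S.exps := by
  induction Θ with
  | nil => simp [expRefutations]
  | cons A Θ ih =>
    rw [expRefutations_cons, Set.add_subset_iff]
    exact fun x hx y hy => S.exps.add_mem hx.2 (ih hy)

theorem add_refutations_whyNots_subset_pole_iff {s : Set M} :
    s + S.refutations (whyNots Θ) ⊆ S.pole ↔ s + S.expRefutations Θ ⊆ S.pole := by
  induction Θ generalizing s with
  | nil => rfl
  | cons A Θ ih =>
    have hcons : S.refutations (whyNots (A :: Θ)) =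
        S.perp (S.perp (S.perp (S.interp A) ∩ S.exps)) + S.refutations (whyNots Θ) := by
      simp only [refutations, List.map_cons, List.sum_cons, interp]
    rw [hcons, expRefutations_cons, ← add_assoc, ih, ← add_assoc, add_right_comm,
      add_perp_perp_subset_pole_iff, add_right_comm]

theorem valid_append_singleton : S.Valid (Γ ++ [A]) ↔ S.refutations Γ ⊆ S.interp A := by
  rw [Valid, refutations_append, refutations_singleton, ← subset_perp_iff, perp_perp_interp]

theorem valid_append_whyNots :
    S.Valid (Γ ++ whyNots Θ) ↔ S.refutations Γ + S.expRefutations Θ ⊆ S.pole := by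
  rw [Valid, refutations_append, add_refutations_whyNots_subset_pole_iff]

theorem valid_append_whyNots_append_singleton :
    S.Valid (Γ ++ whyNots Θ ++ [A]) ↔
      S.refutations Γ + S.expRefutations Θ ⊆ S.interp A := by
  rw [Valid, refutations_append, refutations_append, add_right_comm,
    add_refutations_whyNots_subset_pole_iff, add_right_comm, refutations_singleton,
    ← subset_perp_iff, perp_perp_interp]

theorem valid_ax : S.Valid [A, A.dual] := by
  rw [← List.singleton_append, valid_append_singleton, refutations_singleton, interp_dual]

theorem Valid.cut (h₁ : S.Valid (Γ ++ [A])) (h₂ : S.Valid (Δ ++ [A.dual])) :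
    S.Valid (Γ ++ Δ) := by
  rw [valid_append_singleton] at h₁ h₂
  rw [interp_dual, subset_perp_iff, add_comm] at h₂
  rw [Valid, refutations_append]
  exact (Set.add_subset_add_right h₁).trans h₂

theorem valid_one : S.Valid [one] := by
  rw [← List.nil_append [Formula.one], valid_append_singleton, interp, subset_perp_iff,
    refutations_nil, zero_add]

theorem Valid.perm (h : S.Valid Γ) (hΓΔ : Γ.Perm Δ) : S.Valid Δ := by
  rwa [Valid, refutations, (hΓΔ.map _).sum_eq] at h

theorem Valid.tensor (hA : S.Valid (Γ ++ whyNots Θ ++ [A])) (hB : S.Valid (Δ ++ whyNots Θ ++ [B])) :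
    S.Valid (Γ ++ Δ ++ whyNots Θ ++ [tensor A B]) := by
  rw [valid_append_whyNots_append_singleton] at hA hB ⊢
  rw [refutations_append, interp, subset_perp_iff, add_right_comm]
  refine S.add_subset_pole_of_add_add expRefutations_subset_exps ?_
  calc S.refutations Γ + S.refutations Δ + S.perp (S.interp A + S.interp B) +
          S.expRefutations Θ + S.expRefutations Θ
      = (S.refutations Γ + S.expRefutations Θ) + (S.refutations Δ + S.expRefutations Θ) +
          S.perp (S.interp A + S.interp B) := by abel
    _ ⊆ S.interp A + S.interp B + S.perp (S.interp A + S.interp B) :=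
        Set.add_subset_add_right (Set.add_subset_add hA hB)
    _ ⊆ S.pole := S.subset_perp_iff.1 (S.subset_perp_perp _)

theorem Valid.par (h : S.Valid (Γ ++ [A, B])) : S.Valid (Γ ++ [par A B]) := by
  rw [← List.singleton_append (l := [B]), Valid, refutations_append, refutations_append,
    refutations_singleton, refutations_singleton] at h
  rwa [valid_append_singleton, interp, subset_perp_iff]

theorem Valid.weakening (h : S.Valid Γ) : S.Valid (Γ ++ [whyNot A]) := by
  rw [valid_append_singleton, interp, subset_perp_iff, Set.add_subset_iff]
  exact fun _ hx _ hk => S.weaken (h hx) hk.2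

theorem Valid.contraction (h : S.Valid (Γ ++ [whyNot A, whyNot A])) :
    S.Valid (Γ ++ [whyNot A]) := by
  change S.Valid (Γ ++ whyNots [A, A]) at h
  change S.Valid (Γ ++ whyNots [A])
  have hpair : S.expRefutations [A, A] = S.expRefutations [A] + S.expRefutations [A] := by
    simp only [expRefutations, List.map_cons, List.map_nil, List.sum_cons, List.sum_nil, add_zero]
  rw [valid_append_whyNots] at h ⊢
  rw [hpair, ← add_assoc] at h
  exact S.add_subset_pole_of_add_add expRefutations_subset_exps h

theorem Valid.dereliction (h : S.Valid (Γ ++ [A])) : S.Valid (Γ ++ [whyNot A]) := by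
  rw [valid_append_singleton] at h ⊢
  exact h.trans ((S.subset_perp_perp _).trans (S.perp_anti Set.inter_subset_left))

theorem Valid.promotion (h : S.Valid (whyNots Θ ++ [A])) :
    S.Valid (whyNots Θ ++ [ofCourse A]) := by
  have h' := valid_append_whyNots_append_singleton (Γ := []).1 h
  refine valid_append_whyNots_append_singleton (Γ := []).2 ?_
  rw [refutations_nil, zero_add] at h' ⊢
  exact (Set.subset_inter h' expRefutations_subset_exps).trans (S.subset_perp_perp _)

end PhaseSpace

theorem LLT.valid {M : Type*} [AddCommMonoid M] (S : PhaseSpace M) {Γ : Sequent} (h : LLT Γ) :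
    S.Valid Γ := by
  induction h with
  | ax => exact PhaseSpace.valid_ax
  | cut _ _ _ _ _ h₁ h₂ => exact h₁.cut h₂
  | exchange Γ Δ A B _ h =>
    exact h.perm (((List.Perm.swap A B []).append_left Γ).append_right Δ)
  | one => exact PhaseSpace.valid_one
  | bot _ _ h => exact PhaseSpace.valid_append_singleton.2 h
  | top => exact PhaseSpace.valid_append_singleton.2 (Set.subset_univ _)
  | tensor _ _ _ _ _ _ _ h₁ h₂ => exact h₁.tensor h₂
  | par _ _ _ _ h => exact h.par
  | plusLeft _ _ _ _ h =>
    rw [PhaseSpace.valid_append_singleton] at h ⊢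
    exact (h.trans Set.subset_union_left).trans (S.subset_perp_perp _)
  | plusRight _ _ _ _ h =>
    rw [PhaseSpace.valid_append_singleton] at h ⊢
    exact (h.trans Set.subset_union_right).trans (S.subset_perp_perp _)
  | weakening _ _ _ h => exact h.weakening
  | contraction _ _ _ h => exact h.contraction
  | dereliction _ _ _ h => exact h.dereliction
  | promotion _ _ _ h => exact h.promotion
  | _ _ _ _ _ _ h₁ h₂ =>
    rw [PhaseSpace.valid_append_singleton] at h₁ h₂ ⊢
    exact Set.subset_inter h₁ h₂

/-- The countermodel: the elements of the pole of level `l` are the `(d, l)` with `d + 1` in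
`{0}`, `ℕ ∖ {1}` or `ℕ`, according to whether `l = 0`, `l = 1` or `2 ≤ l`. Level `1` is that of a
proof of `1 & (X ⊗ !X)`, and the levels from `2` on are those of the proofs of `!X`, where
`X = ⊥ ⊗ ⊥`. -/
def semigroupPhaseSpace : PhaseSpace (ℤ × ℕ) where
  pole := {m | m.1 + 1 = 0 ∨ (1 ≤ m.2 ∧ 2 ≤ m.1 + 1) ∨ (2 ≤ m.2 ∧ 0 ≤ m.1 + 1)}
  exps :=
    { carrier := {m | m.1 = 0 ∧ m.2 ≠ 1}
      zero_mem' := by simp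
      add_mem' := by
        simp only [Set.mem_ofPred_eq, Prod.fst_add, Prod.snd_add]
        omega }
  weaken {m k} hm hk := by
    change k.1 = 0 ∧ k.2 ≠ 1 at hk
    simp only [Set.mem_ofPred_eq, Prod.fst_add, Prod.snd_add] at hm ⊢
    omega
  contract {m k} hk hm := by
    change k.1 = 0 ∧ k.2 ≠ 1 at hk
    simp only [Set.mem_ofPred_eq, Prod.fst_add, Prod.snd_add] at hm ⊢
    omega

namespace semigroupPhaseSpace

open PhaseSpace

theorem mem_pole_iff {m : ℤ × ℕ} : m ∈ semigroupPhaseSpace.pole ↔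
    m.1 + 1 = 0 ∨ (1 ≤ m.2 ∧ 2 ≤ m.1 + 1) ∨ (2 ≤ m.2 ∧ 0 ≤ m.1 + 1) := .rfl

theorem mem_exps_iff {m : ℤ × ℕ} : m ∈ semigroupPhaseSpace.exps ↔ m.1 = 0 ∧ m.2 ≠ 1 := .rfl

theorem mem_interp_botTensorBot {m : ℤ × ℕ} :
    m ∈ semigroupPhaseSpace.interp botTensorBot ↔ (1, 0) + m ∈ semigroupPhaseSpace.pole := by
  constructor
  · intro hm
    refine hm ?_
    -- The semigroups of levels `k` and `l` add up into that of level `k + l`.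
    rintro _ ⟨x, hx, y, hy, rfl⟩
    simp only [interp, mem_pole_iff, Prod.fst_add, Prod.snd_add] at hx hy ⊢
    omega
  · intro hm w hw
    have hbot : ((-1, 0) : ℤ × ℕ) ∈ semigroupPhaseSpace.pole := by simp [mem_pole_iff]
    have hw' := hw (Set.add_mem_add hbot hbot)
    simp only [mem_pole_iff, Prod.fst_add, Prod.snd_add] at hm hw' ⊢
    omega

theorem zero_one_mem_interp_one_with_tensor_ofCourse :
    (0, 1) ∈ semigroupPhaseSpace.interp
      (.with one (.tensor botTensorBot (.ofCourse botTensorBot))) := by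
  have hX : (-2, 0) ∈ semigroupPhaseSpace.interp botTensorBot := by
    simp [mem_interp_botTensorBot, mem_pole_iff]
  have hofCourse : (0, 2) ∈ semigroupPhaseSpace.interp (.ofCourse botTensorBot) :=
    semigroupPhaseSpace.subset_perp_perp _
      ⟨by simp [mem_interp_botTensorBot, mem_pole_iff], by simp [mem_exps_iff]⟩
  constructor
  · intro m hm
    simp only [mem_pole_iff, Prod.fst_add, Prod.snd_add] at hm ⊢
    omega
  · intro w hw
    have hw' := hw (Set.add_mem_add hX hofCourse)
    simp only [mem_pole_iff, Prod.fst_add, Prod.snd_add] at hw' ⊢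
    omega

theorem zero_one_notMem_interp_ofCourse :
    (0, 1) ∉ semigroupPhaseSpace.interp (.ofCourse botTensorBot) := by
  have hzero : (0, 0) ∈ semigroupPhaseSpace.perp
      (semigroupPhaseSpace.interp botTensorBot ∩ semigroupPhaseSpace.exps) := by
    rintro k ⟨hX, hexps⟩
    rw [SetLike.mem_coe, mem_exps_iff] at hexps
    simp only [mem_interp_botTensorBot, mem_pole_iff, Prod.fst_add, Prod.snd_add] at hX ⊢
    omega
  intro h
  simpa [mem_pole_iff] using h hzero

theorem not_valid_laurentSequent :
    ¬ semigroupPhaseSpace.Valid (laurentSequent botTensorBot) := by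
  rw [laurentSequent, ← List.singleton_append, valid_append_singleton, refutations_singleton,
    ← interp_dual]
  exact fun h => zero_one_notMem_interp_ofCourse (h zero_one_mem_interp_one_with_tensor_ofCourse)

end semigroupPhaseSpace

theorem not_llt_laurentSequent_botTensorBot : ¬ LLT (laurentSequent botTensorBot) :=
  fun h => semigroupPhaseSpace.not_valid_laurentSequent (h.valid _)

end LinearLogic

theorem mainTheorem9 :
    (¬ LinearLogic.IsModelOf LinearLogic.LLT LinearLogic.LLTN.Provable) ∧
    (¬ LinearLogic.IsModelOf LinearLogic.LLT LinearLogic.LLTN.BoundedProvable) ∧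
    LinearLogic.LLTN.BoundedProvable
      (LinearLogic.laurentSequent LinearLogic.botTensorBot) ∧
    (¬ LinearLogic.LL (LinearLogic.laurentSequent LinearLogic.botTensorBot)) ∧
    (¬ LinearLogic.LLT (LinearLogic.laurentSequent LinearLogic.botTensorBot)) := by
  have hbounded := (LinearLogic.LLTN.CutFreeProvable.laurentSequent
    LinearLogic.botTensorBot).boundedProvable
  have hnot := LinearLogic.not_llt_laurentSequent_botTensorBot
  exact ⟨fun h => hnot (h _ hbounded.provable), fun h => hnot (h _ hbounded), hbounded,
    fun h => hnot h.llt, hnot⟩
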